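/- Let $K$ be a field of characteristic $\neq 2$. The Witt group $W(F)$ of a field $F$ is the Grothendieck group of isomorphism classes of nonsingular symmetric bilinear forms on finite-dimensional $F$-vector spaces (under orthogonal direct sum) modulo the subgroup generated by the hyperbolic forms, i.e. the nonsingular forms that are the direct sum of two isotropic subspaces. For $a\in F^\bullet$ let $[a]\in W(F)$ be the class of the one-dimensional form $(x,y)\mapsto axy$, and for a symmetric matrix $S$ over $F$ with $\det S\neq 0$ let $[S]\in W(F)$ be the class of the corresponding form on $F^n$. For an irreducible polynomial $\pi\in K[X]$ let $\mathrm{res}_\pi: W(K(X))\to W(K[X]/\pi)$ be the residue homomorphism, determined by $\mathrm{res}_\pi[u]=0$ and $\mathrm{res}_\pi[\pi u]=[\bar u]$ for every $u=a/b$ with $a,b\in K[X]$ prime to $\pi$, where $\bar u\in K[X]/\pi$ is the reduction of $u$ modulo $\pi$. Let $P\in K[X]$ be monic and separable (i.e. with distinct roots in an algebraic closure of $K$). Let $P_0=P$, $P_1=P'$ and, as long as $P_k\neq 0$, let $P_{k+1}=P_kQ_k-P_{k-1}$ with $\deg P_{k+1}<\deg P_k$ ($k\geq 1$); let $n$ be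 the first index with $P_{n+1}=0$. Let $\mathrm{Tri}(Q)$ be the symmetric tridiagonal $n\times n$ matrix with diagonal entries $Q_1,\dots,Q_n$ and all entries next to the diagonal equal to $1$. Theorem. $\det \mathrm{Tri}(Q)\neq 0$ in $K(X)$, and for every irreducible $\pi\in K[X]$ $$\mathrm{res}_\pi([\mathrm{Tri}(Q)])=\begin{cases}0\in W(K[X]/\pi) & \text{if }\pi\text{ does not divide }P,\\ [\pi']\in W(K[X]/\pi) & \text{if }\pi\text{ divides }P,\end{cases}$$ where $\pi'$ is the derivative of $\pi$ (which is nonzero modulo $\pi$ when $\pi$ divides $P$). -/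

import Mathlib

open Polynomial

universe u

/-- A nonsingular symmetric form `(V, φ)` over a field `K`. -/
structure NonsingularForm (K : Type u) [Field K] where
  V : Type u
  [addCommGroup : AddCommGroup V]
  [module : Module K V]
  [finite : FiniteDimensional K V]
  form : LinearMap.BilinForm K V
  symm : form.IsSymm
  nondeg : form.Nondegenerate

attribute [instance] NonsingularForm.addCommGroup NonsingularForm.module NonsingularForm.finite

namespace NonsingularForm

variable {K : Type u} [Field K]

theorem nondegenerate_of_left {V : Type u} [AddCommGroup V] [Module K V]
    {B : LinearMap.BilinForm K V} (hs : B.IsSymm)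
    (h : ∀ x, (∀ y, B x y = 0) → x = 0) : B.Nondegenerate :=
  ⟨h, fun y hy => h y fun x => by rw [hs.eq]; exact hy x⟩

theorem eq_zero_of_forall (M : NonsingularForm K) {x : M.V} (h : ∀ y, M.form x y = 0) : x = 0 :=
  M.nondeg.1 x h

/-- The orthogonal direct sum `(V₁ ⊕ V₂, φ₁ ⊕ φ₂)`. -/
abbrev sum (M N : NonsingularForm K) : NonsingularForm K where
  V := M.V × N.V
  form := M.form.compl₁₂ (LinearMap.fst K M.V N.V) (LinearMap.fst K M.V N.V) +
    N.form.compl₁₂ (LinearMap.snd K M.V N.V) (LinearMap.snd K M.V N.V)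
  symm := ⟨fun x y => by simp [M.symm.eq x.1 y.1, N.symm.eq x.2 y.2]⟩
  nondeg := by
    refine nondegenerate_of_left
      ⟨fun x y => by simp [M.symm.eq x.1 y.1, N.symm.eq x.2 y.2]⟩ fun x hx => ?_
    refine Prod.ext (M.eq_zero_of_forall fun y => ?_) (N.eq_zero_of_forall fun y => ?_)
    · simpa using hx (y, 0)
    · simpa using hx (0, y)

/-- The form on the zero vector space. -/
abbrev zero (K : Type u) [Field K] : NonsingularForm K where
  V := PUnit.{u + 1}
  form := 0
  symm := ⟨fun _ _ => rfl⟩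
  nondeg := nondegenerate_of_left ⟨fun _ _ => rfl⟩ fun _ _ => rfl

/-- Isomorphism of symmetric forms. -/
instance isometrySetoid (K : Type u) [Field K] : Setoid (NonsingularForm K) where
  r M N := M.form.Equivalent N.form
  iseqv := ⟨fun M => .refl M.form, fun h => h.symm, fun h h' => h.trans h'⟩

/-- `(V, φ)` is hyperbolic: it is the direct sum of two isotropic subspaces. -/
def IsHyperbolic (M : NonsingularForm K) : Prop :=
  ∃ U U' : Submodule K M.V, IsCompl U U' ∧
    (∀ x ∈ U, ∀ y ∈ U, M.form x y = 0) ∧ (∀ x ∈ U', ∀ y ∈ U', M.form x y = 0)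

/-- The symmetric form on `Kⁿ` with a given symmetric matrix of nonzero determinant. -/
noncomputable abbrev ofMatrix {n : ℕ} (S : Matrix (Fin n) (Fin n) K) (hS : S.IsSymm)
    (hdet : S.det ≠ 0) : NonsingularForm K where
  V := Fin n → K
  form := Matrix.toBilin' S
  symm := Matrix.isSymm_toBilin'_iff_isSymm.mpr hS
  nondeg := LinearMap.BilinForm.nondegenerate_toBilin'_of_det_ne_zero' S hdet

/-- The one-dimensional form `(K, a)`, `φ(x, y) = a x y`. -/
abbrev rankOne (a : K) (ha : a ≠ 0) : NonsingularForm K where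
  V := K
  form := a • LinearMap.mul K K
  symm := ⟨fun x y => by simp [mul_comm x y]⟩
  nondeg := nondegenerate_of_left ⟨fun x y => by simp [mul_comm x y]⟩ fun x hx => by
    simpa [ha] using hx 1

/-- Build an isomorphism of forms from a linear equivalence. -/
theorem equiv_of {M N : NonsingularForm K} (e : M.V ≃ₗ[K] N.V)
    (h : ∀ x y, N.form (e x) (e y) = M.form x y) : M ≈ N :=
  ⟨{ e with map_app' := h }⟩

theorem exists_of_equiv {M N : NonsingularForm K} (h : M ≈ N) :
    ∃ e : M.V ≃ₗ[K] N.V, ∀ x y, N.form (e x) (e y) = M.form x y := by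
  obtain ⟨e⟩ := h
  exact ⟨e.toLinearEquiv, e.map_app'⟩

theorem sum_congr {M M' N N' : NonsingularForm K} (h : M ≈ M') (h' : N ≈ N') :
    M.sum N ≈ M'.sum N' := by
  obtain ⟨e, he⟩ := exists_of_equiv h
  obtain ⟨f, hf⟩ := exists_of_equiv h'
  exact equiv_of (M := M.sum N) (N := M'.sum N') (e.prodCongr f) fun x y => by
    exact congrArg₂ (· + ·) (he _ _) (hf _ _)

end NonsingularForm

/-- The monoid `Sym(K)` of isomorphism classes of nonsingular symmetric forms. -/
def FormClass (K : Type u) [Field K] : Type (u + 1) :=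
  Quotient (NonsingularForm.isometrySetoid K)

namespace FormClass

variable {K : Type u} [Field K]

/-- The isomorphism class of a form. -/
def mk (M : NonsingularForm K) : FormClass K := Quotient.mk _ M

theorem mk_eq {M N : NonsingularForm K} (h : M ≈ N) : mk M = mk N := Quotient.sound h

theorem ind {p : FormClass K → Prop} (h : ∀ M, p (mk M)) (a : FormClass K) : p a :=
  Quotient.ind h a

instance : Add (FormClass K) :=
  ⟨Quotient.map₂ NonsingularForm.sum fun _ _ h _ _ h' => NonsingularForm.sum_congr h h'⟩

instance : Zero (FormClass K) := ⟨mk (NonsingularForm.zero K)⟩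

theorem mk_add (M N : NonsingularForm K) : mk M + mk N = mk (M.sum N) := rfl

theorem mk_zero : mk (NonsingularForm.zero K) = 0 := rfl

instance : AddCommMonoid (FormClass K) where
  add_assoc a b c := by
    induction a using ind with | _ M
    induction b using ind with | _ N
    induction c using ind with | _ P
    exact mk_eq (NonsingularForm.equiv_of
      (LinearEquiv.prodAssoc K M.V N.V P.V) fun x y => (add_assoc _ _ _).symm)
  zero_add a := by
    induction a using ind with | _ M
    exact mk_eq (NonsingularForm.equiv_of
      (LinearEquiv.uniqueProd (R := K) (M := M.V) (M₂ := PUnit.{u + 1}))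
      fun x y => (zero_add _).symm)
  add_zero a := by
    induction a using ind with | _ M
    exact mk_eq (NonsingularForm.equiv_of
      (LinearEquiv.prodUnique (R := K) (M := M.V) (M₂ := PUnit.{u + 1}))
      fun x y => (add_zero _).symm)
  add_comm a b := by
    induction a using ind with | _ M
    induction b using ind with | _ N
    exact mk_eq (NonsingularForm.equiv_of
      (LinearEquiv.prodComm K M.V N.V) fun x y => add_comm _ _)
  nsmul := nsmulRec

end FormClass

/-- The Witt group `W(K)`: the Grothendieck group of `Sym(K)` modulo the subgroup generated by
the hyperbolic forms. -/
def WittGroup (K : Type u) [Field K] : Type (u + 1) :=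
  Algebra.GrothendieckAddGroup (FormClass K) ⧸
    AddSubgroup.closure {x : Algebra.GrothendieckAddGroup (FormClass K) |
      ∃ M : NonsingularForm K, M.IsHyperbolic ∧
        x = Algebra.GrothendieckAddGroup.of (FormClass.mk M)}

namespace WittGroup

variable {K : Type u} [Field K]

noncomputable instance : AddCommGroup (WittGroup K) :=
  inferInstanceAs (AddCommGroup (_ ⧸ AddSubgroup.closure _))

/-- The quotient map `Sym(K) → W(K)`. -/
noncomputable def ofClass : FormClass K →+ WittGroup K :=
  (QuotientAddGroup.mk' _).comp (Algebra.GrothendieckAddGroup.of (M := FormClass K))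

/-- The Witt class `[V, φ]`. -/
noncomputable def mk (M : NonsingularForm K) : WittGroup K := ofClass (FormClass.mk M)

/-- The Witt class `[S]` of a symmetric matrix of nonzero determinant. -/
noncomputable def ofMatrix {n : ℕ} (S : Matrix (Fin n) (Fin n) K) (hS : S.IsSymm)
    (hdet : S.det ≠ 0) : WittGroup K := mk (NonsingularForm.ofMatrix S hS hdet)

/-- The Witt class `[a]` of the form `(K, a)`. -/
noncomputable def rankOne (a : K) (ha : a ≠ 0) : WittGroup K := mk (NonsingularForm.rankOne a ha)

theorem mk_sum (M N : NonsingularForm K) : mk (M.sum N) = mk M + mk N :=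
  (ofClass (K := K)).map_add (FormClass.mk M) (FormClass.mk N)

theorem mk_eq {M N : NonsingularForm K} (h : M ≈ N) : mk M = mk N :=
  congrArg ofClass (FormClass.mk_eq h)

theorem mk_hyperbolic {M : NonsingularForm K} (h : M.IsHyperbolic) : mk M = 0 :=
  (QuotientAddGroup.eq_zero_iff _).mpr (AddSubgroup.subset_closure ⟨M, h, rfl⟩)

/-- The homomorphism out of `W(K)` induced by an additive isomorphism invariant of forms that
vanishes on the hyperbolic forms. -/
noncomputable def lift {A : Type*} [AddCommGroup A] (f : NonsingularForm K → A)
    (hiso : ∀ M N : NonsingularForm K, M ≈ N → f M = f N)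
    (hzero : f (NonsingularForm.zero K) = 0)
    (hadd : ∀ M N : NonsingularForm K, f (M.sum N) = f M + f N)
    (hhyp : ∀ M : NonsingularForm K, M.IsHyperbolic → f M = 0) : WittGroup K →+ A :=
  QuotientAddGroup.lift _
    (Algebra.GrothendieckAddGroup.lift
      ({ toFun := Quotient.lift f hiso
         map_zero' := hzero
         map_add' := fun a b => Quotient.inductionOn₂ a b hadd } : FormClass K →+ A))
    ((AddSubgroup.closure_le _).mpr fun x ⟨M, hM, hx⟩ => by
      subst hx
      exact (DFunLike.congr_fun (Algebra.GrothendieckAddGroup.lift.symm_apply_apply _)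
        (FormClass.mk M)).trans (hhyp M hM))

theorem lift_mk {A : Type*} [AddCommGroup A] (f : NonsingularForm K → A)
    (hiso : ∀ M N : NonsingularForm K, M ≈ N → f M = f N)
    (hzero : f (NonsingularForm.zero K) = 0)
    (hadd : ∀ M N : NonsingularForm K, f (M.sum N) = f M + f N)
    (hhyp : ∀ M : NonsingularForm K, M.IsHyperbolic → f M = 0) (M : NonsingularForm K) :
    lift f hiso hzero hadd hhyp (mk M) = f M :=
  DFunLike.congr_fun (Algebra.GrothendieckAddGroup.lift.symm_apply_apply
    ({ toFun := Quotient.lift f hiso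
       map_zero' := hzero
       map_add' := fun a b => Quotient.inductionOn₂ a b hadd } : FormClass K →+ A))
    (FormClass.mk M)

theorem rankOne_congr {a b : K} (h : a = b) (ha : a ≠ 0) (hb : b ≠ 0) :
    rankOne a ha = rankOne b hb := by
  subst h; rfl

theorem rankOne_mul_sq (a y : K) (ha : a ≠ 0) (hy : y ≠ 0) (h : a * y ^ 2 ≠ 0) :
    rankOne (a * y ^ 2) h = rankOne a ha :=
  mk_eq (NonsingularForm.equiv_of (M := NonsingularForm.rankOne (a * y ^ 2) h)
    (N := NonsingularForm.rankOne a ha)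
    (LinearEquiv.smulOfNeZero K K y hy) fun x z => by
      change a * ((y * x) * (y * z)) = a * y ^ 2 * (x * z)
      ring)

theorem rankOne_add_neg (h2 : (2 : K) ≠ 0) (a : K) (ha : a ≠ 0) (hna : -a ≠ 0) :
    rankOne a ha + rankOne (-a) hna = 0 := by
  rw [rankOne, rankOne, ← mk_sum]
  refine mk_hyperbolic ⟨(LinearMap.range ((LinearMap.id : K →ₗ[K] K).prod LinearMap.id) :
      Submodule K (K × K)), (LinearMap.range ((LinearMap.id : K →ₗ[K] K).prod (-LinearMap.id)) :
      Submodule K (K × K)), ⟨?_, ?_⟩, ?_, ?_⟩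
  · rw [Submodule.disjoint_def]
    rintro _ ⟨s, rfl⟩ ⟨t, ht⟩
    have h1 : t = s := congrArg Prod.fst ht
    have h3 : -t = s := congrArg Prod.snd ht
    have h4 : (2 : K) * s = 0 := by linear_combination -h1 - h3
    have h5 : s = 0 := (mul_eq_zero.mp h4).resolve_left h2
    subst h5
    exact map_zero _
  · rw [codisjoint_iff, eq_top_iff]
    rintro ⟨p, q⟩ -
    refine Submodule.mem_sup.mpr ⟨((p + q) / 2, (p + q) / 2), ⟨(p + q) / 2, rfl⟩,
      ((p - q) / 2, -((p - q) / 2)), ⟨(p - q) / 2, rfl⟩, ?_⟩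
    refine Prod.ext ?_ ?_
    · change (p + q) / 2 + (p - q) / 2 = p
      field_simp; ring
    · change (p + q) / 2 + -((p - q) / 2) = q
      field_simp; ring
  · rintro _ ⟨s, rfl⟩ _ ⟨t, rfl⟩
    change a * (s * t) + -a * (s * t) = 0
    ring
  · rintro _ ⟨s, rfl⟩ _ ⟨t, rfl⟩
    change a * (s * t) + -a * (-s * -t) = 0
    ring

theorem rankOne_add (a b : K) (ha : a ≠ 0) (hb : b ≠ 0) (hab : a + b ≠ 0)
    (hp : a * b * (a + b) ≠ 0) :
    rankOne a ha + rankOne b hb = rankOne (a + b) hab + rankOne (a * b * (a + b)) hp := by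
  simp only [rankOne, ← mk_sum]
  refine (mk_eq (NonsingularForm.equiv_of
    (M := (NonsingularForm.rankOne (a + b) hab).sum (NonsingularForm.rankOne _ hp))
    (N := (NonsingularForm.rankOne a ha).sum (NonsingularForm.rankOne b hb))
    ({ toFun := fun p => (p.1 + b * p.2, p.1 - a * p.2)
       map_add' := fun p q => by ext <;> simp <;> ring
       map_smul' := fun c p => by ext <;> simp <;> ring
       invFun := fun p => ((a * p.1 + b * p.2) / (a + b), (p.1 - p.2) / (a + b))
       left_inv := fun p => by ext <;> simp <;> field_simp <;> ring
       right_inv := fun p => by ext <;> simp <;> field_simp <;> ring } : (K × K) ≃ₗ[K] (K × K))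
    fun x y => ?_)).symm
  change a * ((x.1 + b * x.2) * (y.1 + b * y.2)) + b * ((x.1 - a * x.2) * (y.1 - a * y.2)) =
    (a + b) * (x.1 * y.1) + a * b * (a + b) * (x.2 * y.2)
  ring

end WittGroup

/-- A list of pairwise orthogonal vectors, none of them isotropic. -/
def IsOrthoList {F V : Type*} [Field F] [AddCommGroup V] [Module F V]
    (B : LinearMap.BilinForm F V) (l : List V) : Prop :=
  l.Pairwise (fun x y => B x y = 0) ∧ ∀ x ∈ l, B x x ≠ 0

namespace IsOrthoList

variable {F V : Type*} [Field F] [AddCommGroup V] [Module F V] {B : LinearMap.BilinForm F V}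

theorem cons_iff {v : V} {l : List V} :
    IsOrthoList B (v :: l) ↔ (∀ x ∈ l, B v x = 0) ∧ B v v ≠ 0 ∧ IsOrthoList B l := by
  simp only [IsOrthoList, List.pairwise_cons, List.mem_cons, forall_eq_or_imp]
  tauto

theorem span_cons (v : V) (l : List V) :
    Submodule.span F {x | x ∈ v :: l} = Submodule.span F {v} ⊔ Submodule.span F {x | x ∈ l} := by
  rw [← Submodule.span_union]
  congr 1
  ext x
  simp

theorem apply_eq_zero {v : V} {l : List V} (h : ∀ x ∈ l, B v x = 0) {y : V}
    (hy : y ∈ Submodule.span F {x | x ∈ l}) : B v y = 0 := by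
  have : Submodule.span F {x | x ∈ l} ≤ LinearMap.ker (B v) :=
    Submodule.span_le.mpr fun x hx => h x hx
  exact this hy

theorem exists_cons_span_eq (hs : B.IsSymm) (h2 : (2 : F) ≠ 0) {A : Type*} [AddCommGroup A] (r : F → A)
    (hsq : ∀ x y, x ≠ 0 → y ≠ 0 → r (x * y ^ 2) = r x)
    (hadd : ∀ x y, x ≠ 0 → y ≠ 0 → x + y ≠ 0 → r x + r y = r (x + y) + r (x * y * (x + y))) :
    ∀ (l : List V), IsOrthoList B l → ∀ w ∈ Submodule.span F {x | x ∈ l}, B w w ≠ 0 →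
      ∃ l', IsOrthoList B (w :: l') ∧
        Submodule.span F {x | x ∈ w :: l'} = Submodule.span F {x | x ∈ l} ∧
        ((w :: l').map fun x => r (B x x)).sum = (l.map fun x => r (B x x)).sum := by
  intro l
  induction l with
  | nil =>
    intro _ w hw hww
    have : w = 0 := by simpa using hw
    simp [this] at hww
  | cons v l ih =>
    intro hl w hw hww
    obtain ⟨hvl, hvv, hl'⟩ := cons_iff.mp hl
    rw [span_cons, Submodule.mem_sup] at hw
    obtain ⟨v', hv', w', hw', rfl⟩ := hw
    obtain ⟨x, rfl⟩ := Submodule.mem_span_singleton.mp hv'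
    have hvw' : B v w' = 0 := apply_eq_zero hvl hw'
    have hw'v : B w' v = 0 := by rw [hs.eq]; exact hvw'
    by_cases hx : x = 0
    · subst hx
      simp only [zero_smul, zero_add] at hww ⊢
      obtain ⟨l', ho, hsp, hsum⟩ := ih hl' w' hw' hww
      obtain ⟨h1, h3, h4⟩ := cons_iff.mp ho
      refine ⟨v :: l', ?_, ?_, ?_⟩
      · refine cons_iff.mpr ⟨?_, h3, cons_iff.mpr ⟨?_, hvv, h4⟩⟩
        · intro z hz
          rcases List.mem_cons.mp hz with rfl | hz
          · exact hw'v
          · exact h1 z hz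
        · intro z hz
          refine apply_eq_zero hvl ?_
          rw [← hsp]
          exact Submodule.subset_span (List.mem_cons_of_mem _ hz)
      · rw [span_cons, span_cons v, span_cons v, ← hsp, span_cons, sup_left_comm]
      · simp only [List.map_cons, List.sum_cons] at hsum ⊢
        rw [← hsum]; abel
    · by_cases hw0 : B w' w' = 0
      · -- reflection in `u = 2 x v + w'`
        set u : V := (2 * x) • v + w' with hu
        have huu : B u u = 4 * x ^ 2 * B v v := by
          simp [hu, hvw', hw'v, hw0]; ring
        have huu0 : B u u ≠ 0 := by
          rw [huu]
          have : (4 : F) = 2 * 2 := by norm_num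
          rw [this]
          exact mul_ne_zero (mul_ne_zero (mul_ne_zero h2 h2) (pow_ne_zero _ hx)) hvv
        let σ : V →ₗ[F] V := LinearMap.id - (2 / B u u) • (B u).smulRight u
        have hσ : ∀ y, σ y = y - (2 / B u u * B u y) • u := fun y => by
          simp [σ, smul_smul]
        have hiso : ∀ y z, B (σ y) (σ z) = B y z := by
          intro y z
          simp only [hσ, map_sub, map_smul, LinearMap.sub_apply, LinearMap.smul_apply, smul_eq_mul]
          rw [hs.eq y u]
          field_simp
          ring
        have hinv : ∀ y, σ (σ y) = y := by
          intro y
          simp only [hσ, map_sub, map_smul, smul_eq_mul]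
          rw [sub_sub, ← add_smul]
          have : 2 / B u u * B u y + 2 / B u u * (B u y - 2 / B u u * B u y * B u u) = 0 := by
            field_simp; ring
          rw [this, zero_smul, sub_zero]
        have hσv : σ v = (-x⁻¹) • (x • v + w') := by
          rw [hσ]
          have h1 : B u v = 2 * x * B v v := by simp [hu, hw'v]
          have h3 : 2 / B u u * B u v = x⁻¹ := by
            rw [huu, h1]
            have h4 : (4 : F) = 2 * 2 := by norm_num
            rw [h4]
            field_simp
          rw [h3, hu]
          simp only [smul_add, smul_smul, neg_mul, inv_mul_cancel₀ hx, neg_smul, one_smul]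
          have : x⁻¹ * (2 * x) = 2 := by field_simp
          rw [this, two_smul]; abel
        have hxw : x • v + w' = (-x) • σ v := by
          rw [hσv, smul_smul]
          have : -x * -x⁻¹ = 1 := by field_simp
          rw [this, one_smul]
        have hus : u ∈ Submodule.span F {z | z ∈ v :: l} := by
          rw [span_cons]
          exact Submodule.add_mem_sup (Submodule.smul_mem _ _ (Submodule.mem_span_singleton_self v))
            hw'
        have hσs : ∀ y ∈ Submodule.span F {z | z ∈ v :: l},
            σ y ∈ Submodule.span F {z | z ∈ v :: l} := fun y hy => by
          rw [hσ]; exact Submodule.sub_mem _ hy (Submodule.smul_mem _ _ hus)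
        have hmap : (Submodule.span F {z | z ∈ v :: l}).map σ =
            Submodule.span F {z | z ∈ v :: l} := by
          refine le_antisymm ?_ ?_
          · rintro _ ⟨y, hy, rfl⟩; exact hσs y hy
          · intro y hy; exact ⟨σ y, hσs y hy, hinv y⟩
        refine ⟨l.map σ, ?_, ?_, ?_⟩
        · refine cons_iff.mpr ⟨?_, hww, ?_, ?_⟩
          · intro z hz
            obtain ⟨y, hy, rfl⟩ := List.mem_map.mp hz
            rw [hxw]
            simp [hiso, hvl y hy]
          · rw [List.pairwise_map]
            exact hl'.1.imp fun {a b} h => by rw [hiso]; exact h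
          · intro z hz
            obtain ⟨y, hy, rfl⟩ := List.mem_map.mp hz
            rw [hiso]; exact hl'.2 y hy
        · rw [← hmap, Submodule.map_span, span_cons, hxw,
            Submodule.span_singleton_smul_eq (neg_ne_zero.mpr hx).isUnit,
            ← Submodule.span_union]
          congr 1
          ext z
          simp [eq_comm]
        · simp only [List.map_cons, List.sum_cons, List.map_map, Function.comp_def, hiso]
          congr 1
          rw [hxw]
          have : B ((-x) • σ v) ((-x) • σ v) = B v v * x ^ 2 := by
            simp [hiso]; ring
          rw [this, hsq _ _ hvv hx]
      · obtain ⟨l', ho, hsp, hsum⟩ := ih hl' w' hw' hw0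
        obtain ⟨h1, h3, h4⟩ := cons_iff.mp ho
        have hvl' : ∀ z ∈ l', B v z = 0 := fun z hz => by
          refine apply_eq_zero hvl ?_
          rw [← hsp]
          exact Submodule.subset_span (List.mem_cons_of_mem _ hz)
        have hww' : B (x • v + w') (x • v + w') = B v v * x ^ 2 + B w' w' := by
          simp [hvw', hw'v]; ring
        set t : V := (B w' w') • v - (x * B v v) • w' with ht
        have htt : B t t = (B v v * B w' w' * (B v v * x ^ 2 + B w' w')) := by
          simp [ht, hvw', hw'v]; ring
        have hne : B v v * x ^ 2 + B w' w' ≠ 0 := hww' ▸ hww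
        refine ⟨t :: l', ?_, ?_, ?_⟩
        · refine cons_iff.mpr ⟨?_, hww, cons_iff.mpr ⟨?_, ?_, h4⟩⟩
          · intro z hz
            rcases List.mem_cons.mp hz with rfl | hz
            · simp [ht, hvw', hw'v]; ring
            · simp [hvl' z hz, h1 z hz]
          · intro z hz
            simp [ht, hvl' z hz, h1 z hz]
          · rw [htt]
            exact mul_ne_zero (mul_ne_zero hvv hw0) hne
        · rw [span_cons, span_cons t, span_cons v, ← hsp, span_cons w', ← sup_assoc, ← sup_assoc]
          congr 1
          refine le_antisymm (sup_le ?_ ?_) (sup_le ?_ ?_)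
          · rw [Submodule.span_singleton_le_iff_mem]
            exact Submodule.add_mem_sup
              (Submodule.smul_mem _ _ (Submodule.mem_span_singleton_self v))
              (Submodule.mem_span_singleton_self w')
          · rw [Submodule.span_singleton_le_iff_mem, ht, sub_eq_add_neg]
            exact Submodule.add_mem_sup
              (Submodule.smul_mem _ _ (Submodule.mem_span_singleton_self v))
              (Submodule.neg_mem _ (Submodule.smul_mem _ _ (Submodule.mem_span_singleton_self w')))
          · rw [Submodule.span_singleton_le_iff_mem]
            refine Submodule.mem_sup.mpr
              ⟨(x * B v v * (B v v * x ^ 2 + B w' w')⁻¹) • (x • v + w'),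
                Submodule.smul_mem _ _ (Submodule.mem_span_singleton_self _),
                (B v v * x ^ 2 + B w' w')⁻¹ • t,
                Submodule.smul_mem _ _ (Submodule.mem_span_singleton_self _), ?_⟩
            rw [ht]
            have hD := mul_inv_cancel₀ hne
            match_scalars
            · linear_combination hD
            · ring
          · rw [Submodule.span_singleton_le_iff_mem]
            refine Submodule.mem_sup.mpr
              ⟨(B w' w' * (B v v * x ^ 2 + B w' w')⁻¹) • (x • v + w'),
                Submodule.smul_mem _ _ (Submodule.mem_span_singleton_self _),
                (-x * (B v v * x ^ 2 + B w' w')⁻¹) • t,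
                Submodule.smul_mem _ _ (Submodule.mem_span_singleton_self _), ?_⟩
            rw [ht]
            have hD := mul_inv_cancel₀ hne
            match_scalars
            · ring
            · linear_combination hD
        · simp only [List.map_cons, List.sum_cons] at hsum ⊢
          rw [← hsum, hww', htt, ← add_assoc, ← add_assoc]
          congr 1
          have hvx : B v v * x ^ 2 ≠ 0 := mul_ne_zero hvv (pow_ne_zero _ hx)
          have e1 := hadd (B v v * x ^ 2) (B w' w') hvx hw0 hne
          rw [hsq _ _ hvv hx] at e1
          have e2 : B v v * x ^ 2 * B w' w' * (B v v * x ^ 2 + B w' w') =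
              B v v * B w' w' * (B v v * x ^ 2 + B w' w') * x ^ 2 := by ring
          rw [e2, hsq _ _ (mul_ne_zero (mul_ne_zero hvv hw0) hne) hx] at e1
          exact e1.symm

theorem span_tail_eq {w : V} {l m : List V} (hl : IsOrthoList B (w :: l))
    (hm : IsOrthoList B (w :: m))
    (h : Submodule.span F {x | x ∈ w :: l} = Submodule.span F {x | x ∈ w :: m}) :
    Submodule.span F {x | x ∈ l} ≤ Submodule.span F {x | x ∈ m} := by
  intro y hy
  have hy' : y ∈ Submodule.span F {x | x ∈ w :: m} := by
    rw [← h, span_cons]; exact Submodule.mem_sup_right hy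
  rw [span_cons, Submodule.mem_sup] at hy'
  obtain ⟨v, hv, z, hz, rfl⟩ := hy'
  obtain ⟨c, rfl⟩ := Submodule.mem_span_singleton.mp hv
  obtain ⟨h1, h3, -⟩ := cons_iff.mp hl
  obtain ⟨h4, -, -⟩ := cons_iff.mp hm
  have e := apply_eq_zero h1 hy
  rw [map_add, map_smul, apply_eq_zero h4 hz, add_zero, smul_eq_mul] at e
  have hc := (mul_eq_zero.mp e).resolve_right h3
  rwa [hc, zero_smul, zero_add]

theorem sum_eq (hs : B.IsSymm) (h2 : (2 : F) ≠ 0) {A : Type*} [AddCommGroup A] (r : F → A)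
    (hsq : ∀ x y, x ≠ 0 → y ≠ 0 → r (x * y ^ 2) = r x)
    (hadd : ∀ x y, x ≠ 0 → y ≠ 0 → x + y ≠ 0 → r x + r y = r (x + y) + r (x * y * (x + y))) :
    ∀ (m l : List V), IsOrthoList B m → IsOrthoList B l →
      Submodule.span F {x | x ∈ l} = Submodule.span F {x | x ∈ m} →
      (l.map fun x => r (B x x)).sum = (m.map fun x => r (B x x)).sum := by
  intro m
  induction m with
  | nil =>
    intro l _ hl h
    cases l with
    | nil => rfl
    | cons v l =>
      have hv : v ∈ Submodule.span F {x | x ∈ ([] : List V)} := by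
        rw [← h]; exact Submodule.subset_span (List.mem_cons_self)
      have hv0 : v = 0 := by simpa using hv
      exact absurd (by simp [hv0]) (cons_iff.mp hl).2.1
  | cons w m ih =>
    intro l hm hl h
    have hw : w ∈ Submodule.span F {x | x ∈ l} := by
      rw [h]; exact Submodule.subset_span (List.mem_cons_self)
    obtain ⟨l', ho, hsp, hsum⟩ := exists_cons_span_eq hs h2 r hsq hadd l hl w hw (cons_iff.mp hm).2.1
    have h' := hsp.trans h
    have := ih l' (cons_iff.mp hm).2.2 (cons_iff.mp ho).2.2
      (le_antisymm (span_tail_eq ho hm h') (span_tail_eq hm ho h'.symm))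
    rw [← hsum, List.map_cons, List.map_cons, List.sum_cons, List.sum_cons, this]

end IsOrthoList

theorem NonsingularForm.exists_orthoList {K : Type u} [Field K] (h2 : (2 : K) ≠ 0)
    (M : NonsingularForm K) :
    ∃ l : List M.V, IsOrthoList M.form l ∧ Submodule.span K {x | x ∈ l} = ⊤ := by
  have : Invertible (2 : K) := invertibleOfNonzero h2
  obtain ⟨b, hb⟩ := LinearMap.BilinForm.exists_orthogonal_basis (B := M.form)
    ⟨fun x y => M.symm.eq x y⟩
  refine ⟨List.ofFn b, ⟨?_, ?_⟩, ?_⟩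
  · rw [List.pairwise_ofFn]
    intro i j hij
    exact hb hij.ne
  · intro x hx
    obtain ⟨i, rfl⟩ := (List.mem_ofFn' _ _).mp hx
    intro h0
    refine b.ne_zero i (M.eq_zero_of_forall fun y => ?_)
    have : M.form (b i) = 0 := b.ext fun j => by
      by_cases hij : i = j
      · subst hij; exact h0
      · exact hb hij
    rw [this]; rfl
  · have : {x | x ∈ List.ofFn b} = Set.range b := by
      ext x; simp [List.mem_ofFn']
    rw [this]; exact b.span_eq

namespace NonsingularForm

variable {K : Type u} [Field K] {A : Type*} [AddCommGroup A]

/-- `∑ r(aᵢ)` for a diagonalization `(V, φ) ≅ ⊕ (K, aᵢ)`. -/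
noncomputable def diagSum (h2 : (2 : K) ≠ 0) (r : K → A) (M : NonsingularForm K) : A :=
  ((M.exists_orthoList h2).choose.map fun x => r (M.form x x)).sum

theorem diagSum_eq (h2 : (2 : K) ≠ 0) (r : K → A)
    (hsq : ∀ x y, x ≠ 0 → y ≠ 0 → r (x * y ^ 2) = r x)
    (hadd : ∀ x y, x ≠ 0 → y ≠ 0 → x + y ≠ 0 → r x + r y = r (x + y) + r (x * y * (x + y)))
    (M : NonsingularForm K) (l : List M.V) (hl : IsOrthoList M.form l)
    (hsp : Submodule.span K {x | x ∈ l} = ⊤) :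
    diagSum h2 r M = (l.map fun x => r (M.form x x)).sum :=
  IsOrthoList.sum_eq M.symm h2 r hsq hadd _ _ hl (M.exists_orthoList h2).choose_spec.1
    ((M.exists_orthoList h2).choose_spec.2.trans hsp.symm)

theorem diagSum_congr (h2 : (2 : K) ≠ 0) (r : K → A)
    (hsq : ∀ x y, x ≠ 0 → y ≠ 0 → r (x * y ^ 2) = r x)
    (hadd : ∀ x y, x ≠ 0 → y ≠ 0 → x + y ≠ 0 → r x + r y = r (x + y) + r (x * y * (x + y)))
    (M N : NonsingularForm K) (h : M ≈ N) : diagSum h2 r M = diagSum h2 r N := by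
  obtain ⟨e, he⟩ := exists_of_equiv h
  obtain ⟨l, hl, hsp⟩ := M.exists_orthoList h2
  rw [diagSum_eq h2 r hsq hadd M l hl hsp, diagSum_eq h2 r hsq hadd N (l.map e) ⟨?_, ?_⟩ ?_]
  · simp only [List.map_map, Function.comp_def, he]
  · rw [List.pairwise_map]
    exact hl.1.imp fun {a b} h => by rw [he]; exact h
  · intro z hz
    obtain ⟨y, hy, rfl⟩ := List.mem_map.mp hz
    rw [he]; exact hl.2 y hy
  · have : {x | x ∈ l.map e} = e '' {x | x ∈ l} := by ext; simp
    rw [this, Submodule.span_image_linearEquiv, hsp]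
    simp

theorem diagSum_sum (h2 : (2 : K) ≠ 0) (r : K → A)
    (hsq : ∀ x y, x ≠ 0 → y ≠ 0 → r (x * y ^ 2) = r x)
    (hadd : ∀ x y, x ≠ 0 → y ≠ 0 → x + y ≠ 0 → r x + r y = r (x + y) + r (x * y * (x + y)))
    (M N : NonsingularForm K) :
    diagSum h2 r (M.sum N) = diagSum h2 r M + diagSum h2 r N := by
  obtain ⟨l, hl, hsp⟩ := M.exists_orthoList h2
  obtain ⟨m, hm, hsp'⟩ := N.exists_orthoList h2
  rw [diagSum_eq h2 r hsq hadd M l hl hsp, diagSum_eq h2 r hsq hadd N m hm hsp',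
    diagSum_eq h2 r hsq hadd (M.sum N)
      (l.map (fun x => (x, 0)) ++ m.map (fun x => (0, x))) ⟨?_, ?_⟩ ?_]
  · simp [Function.comp_def]
  · rw [List.pairwise_append, List.pairwise_map, List.pairwise_map]
    refine ⟨hl.1.imp fun {a b} h => by simpa using h, hm.1.imp fun {a b} h => by simpa using h, ?_⟩
    intro x hx y hy
    obtain ⟨x, -, rfl⟩ := List.mem_map.mp hx
    obtain ⟨y, -, rfl⟩ := List.mem_map.mp hy
    simp
  · intro z hz
    rcases List.mem_append.mp hz with hz | hz
    · obtain ⟨y, hy, rfl⟩ := List.mem_map.mp hz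
      simpa using hl.2 y hy
    · obtain ⟨y, hy, rfl⟩ := List.mem_map.mp hz
      simpa using hm.2 y hy
  · have : {x | x ∈ l.map (fun x => ((x, 0) : M.V × N.V)) ++ m.map (fun x => (0, x))} =
        (LinearMap.inl K M.V N.V) '' {x | x ∈ l} ∪ (LinearMap.inr K M.V N.V) '' {x | x ∈ m} := by
      ext; simp
    rw [this, Submodule.span_union, Submodule.span_image, Submodule.span_image, hsp, hsp']
    rw [Submodule.map_top, Submodule.map_top, LinearMap.sup_range_inl_inr]

theorem diagSum_hyperbolic (h2 : (2 : K) ≠ 0) (r : K → A)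
    (hsq : ∀ x y, x ≠ 0 → y ≠ 0 → r (x * y ^ 2) = r x)
    (hadd : ∀ x y, x ≠ 0 → y ≠ 0 → x + y ≠ 0 → r x + r y = r (x + y) + r (x * y * (x + y)))
    (hneg : ∀ x, x ≠ 0 → r x + r (-x) = 0)
    (M : NonsingularForm K) (h : M.IsHyperbolic) : diagSum h2 r M = 0 := by
  obtain ⟨U, U', hc, hU, hU'⟩ := h
  have hsup : ∀ z : M.V, ∃ x ∈ U, ∃ y ∈ U', x + y = z := fun z =>
    Submodule.mem_sup.mp (hc.sup_eq_top ▸ Submodule.mem_top)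
  let b := Module.finBasis K U
  let c := (b.prod (Module.finBasis K U')).map (Submodule.prodEquivOfIsCompl U U' hc)
  have hcl : ∀ i, c (Sum.inl i) = b i := fun i => by simp [c]
  have hcr : ∀ i, c (Sum.inr i) = Module.finBasis K U' i := fun i => by simp [c]
  let d := fun i => M.form.dualBasis M.nondeg c (Sum.inl i)
  have hdb : ∀ i j, M.form (d i) (b j) = if i = j then 1 else 0 := fun i j => by
    rw [← hcl, LinearMap.BilinForm.apply_dualBasis_left]
    simp [eq_comm]
  have hbd : ∀ i j, M.form (b i) (d j) = if i = j then 1 else 0 := fun i j => by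
    rw [M.symm.eq, hdb]; simp [eq_comm]
  have hdU' : ∀ i, ∀ y ∈ U', M.form (d i) y = 0 := by
    intro i y hy
    have : (M.form (d i)).comp U'.subtype = 0 := (Module.finBasis K U').ext fun j => by
      simp only [LinearMap.comp_apply, Submodule.subtype_apply, LinearMap.zero_apply]
      rw [← hcr, LinearMap.BilinForm.apply_dualBasis_left]
      simp
    exact DFunLike.congr_fun this ⟨y, hy⟩
  have hd : ∀ i, d i ∈ U' := by
    intro i
    obtain ⟨x, hx, y, hy, hxy⟩ := hsup (d i)
    have hx0 : x = 0 := M.eq_zero_of_forall fun z => by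
      obtain ⟨x', hx', y', hy', rfl⟩ := hsup z
      have h1 := hdU' i y' hy'
      rw [← hxy, map_add, LinearMap.add_apply, hU' y hy y' hy', add_zero] at h1
      rw [map_add, hU x hx x' hx', h1, add_zero]
    rw [← hxy, hx0, zero_add]; exact hy
  have hbb : ∀ i j, M.form (b i) (b j) = 0 := fun i j => hU _ (b i).2 _ (b j).2
  have hdd : ∀ i j, M.form (d i) (d j) = 0 := fun i j => hU' _ (hd i) _ (hd j)
  rw [diagSum_eq h2 r hsq hadd M (List.ofFn (fun i => (b i : M.V) + d i) ++
    List.ofFn (fun i => (b i : M.V) - d i)) ⟨?_, ?_⟩ ?_]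
  · rw [List.map_append, List.sum_append, List.map_ofFn, List.map_ofFn, List.sum_ofFn,
      List.sum_ofFn, ← Finset.sum_add_distrib]
    refine Finset.sum_eq_zero fun i _ => ?_
    have h1 : M.form ((b i : M.V) + d i) ((b i : M.V) + d i) = 2 := by
      simp [hbb, hdd, hbd, hdb]; norm_num
    have h3 : M.form ((b i : M.V) - d i) ((b i : M.V) - d i) = -2 := by
      simp [hbb, hdd, hbd, hdb]; norm_num
    simp only [Function.comp_apply, h1, h3]
    exact hneg 2 h2
  · rw [List.pairwise_append, List.pairwise_ofFn, List.pairwise_ofFn]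
    refine ⟨fun i j hij => ?_, fun i j hij => ?_, fun x hx y hy => ?_⟩
    · simp [hbb, hdd, hbd, hdb, hij.ne]
    · simp [hbb, hdd, hbd, hdb, hij.ne]
    · obtain ⟨i, rfl⟩ := (List.mem_ofFn' _ _).mp hx
      obtain ⟨j, rfl⟩ := (List.mem_ofFn' _ _).mp hy
      simp [hbb, hdd, hbd, hdb]
  · intro x hx
    rcases List.mem_append.mp hx with hx | hx
    · obtain ⟨i, rfl⟩ := (List.mem_ofFn' _ _).mp hx
      have h1 : M.form ((b i : M.V) + d i) ((b i : M.V) + d i) = 2 := by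
        simp [hbb, hdd, hbd, hdb]; norm_num
      rw [h1]; exact h2
    · obtain ⟨i, rfl⟩ := (List.mem_ofFn' _ _).mp hx
      have h3 : M.form ((b i : M.V) - d i) ((b i : M.V) - d i) = -2 := by
        simp [hbb, hdd, hbd, hdb]; norm_num
      rw [h3]; exact neg_ne_zero.mpr h2
  · set S := Submodule.span K {x | x ∈ List.ofFn (fun i => (b i : M.V) + d i) ++
      List.ofFn (fun i => (b i : M.V) - d i)} with hS
    have hp : ∀ i, (b i : M.V) + d i ∈ S := fun i =>
      Submodule.subset_span (List.mem_append_left _ ((List.mem_ofFn' _ _).mpr ⟨i, rfl⟩))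
    have hm : ∀ i, (b i : M.V) - d i ∈ S := fun i =>
      Submodule.subset_span (List.mem_append_right _ ((List.mem_ofFn' _ _).mpr ⟨i, rfl⟩))
    have hbS : ∀ i, (b i : M.V) ∈ S := fun i => by
      have e : (b i : M.V) = (2 : K)⁻¹ • (((b i : M.V) + d i) + ((b i : M.V) - d i)) := by
        match_scalars <;> field_simp <;> norm_num
      rw [e]
      exact Submodule.smul_mem _ _ (Submodule.add_mem _ (hp i) (hm i))
    have hdS : ∀ i, d i ∈ S := fun i => by
      have e : d i = ((b i : M.V) + d i) - b i := by abel
      rw [e]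
      exact Submodule.sub_mem _ (hp i) (hbS i)
    rw [eq_top_iff]
    intro z _
    obtain ⟨x, hx, y, hy, rfl⟩ := hsup z
    refine Submodule.add_mem _ ?_ ?_
    · have : U.subtype ⟨x, hx⟩ ∈ S := by
        rw [← b.sum_repr ⟨x, hx⟩, map_sum]
        exact Submodule.sum_mem _ fun i _ => by
          rw [map_smul]; exact Submodule.smul_mem _ _ (hbS i)
      exact this
    · have e : y = ∑ i, M.form (b i) y • d i := by
        refine sub_eq_zero.mp (M.eq_zero_of_forall fun z => ?_)
        obtain ⟨x', hx', y', hy', rfl⟩ := hsup z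
        have hyU' : y - ∑ i, M.form (b i) y • d i ∈ U' := Submodule.sub_mem _ hy
          (Submodule.sum_mem _ fun i _ => Submodule.smul_mem _ _ (hd i))
        rw [map_add, hU' _ hyU' y' hy', add_zero]
        have : (M.form (y - ∑ i, M.form (b i) y • d i)).comp U.subtype = 0 := b.ext fun j => by
          simp [hdb, M.symm.eq y (b j)]
        exact DFunLike.congr_fun this ⟨x', hx'⟩
      rw [e]
      exact Submodule.sum_mem _ fun i _ => Submodule.smul_mem _ _ (hdS i)

end NonsingularForm

namespace WittGroup

section Residue

variable {K : Type u} [Field K]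

/-- The class `[a]` for `a ≠ 0`, extended by `0` to `a = 0`. -/
noncomputable def rankOneOrZero (a : K) : WittGroup K :=
  open scoped Classical in if h : a ≠ 0 then rankOne a h else 0

theorem rankOneOrZero_of_ne {a : K} (h : a ≠ 0) : rankOneOrZero a = rankOne a h := dif_pos h

theorem rankOneOrZero_mul_sq (a y : K) (ha : a ≠ 0) (hy : y ≠ 0) :
    rankOneOrZero (a * y ^ 2) = rankOneOrZero a := by
  rw [rankOneOrZero_of_ne ha, rankOneOrZero_of_ne (mul_ne_zero ha (pow_ne_zero 2 hy)),
    rankOne_mul_sq a y ha hy]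

theorem rankOneOrZero_add_neg (h2 : (2 : K) ≠ 0) (a : K) (ha : a ≠ 0) :
    rankOneOrZero a + rankOneOrZero (-a) = 0 := by
  rw [rankOneOrZero_of_ne ha, rankOneOrZero_of_ne (neg_ne_zero.mpr ha), rankOne_add_neg h2]

theorem rankOneOrZero_add (a b : K) (ha : a ≠ 0) (hb : b ≠ 0) (hab : a + b ≠ 0) :
    rankOneOrZero a + rankOneOrZero b =
      rankOneOrZero (a + b) + rankOneOrZero (a * b * (a + b)) := by
  rw [rankOneOrZero_of_ne ha, rankOneOrZero_of_ne hb, rankOneOrZero_of_ne hab,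
    rankOneOrZero_of_ne (mul_ne_zero (mul_ne_zero ha hb) hab), rankOne_add a b ha hb]

variable (π : K[X]) [Fact (Irreducible π)]

/-- For a nonzero polynomial `f = π ^ m * g` with `g` prime to `π`: the class of `g` modulo `π`
if `m` is odd, and `0` if `m` is even. -/
noncomputable def polyResidue (f : K[X]) : WittGroup (AdjoinRoot π) :=
  open scoped Classical in
  if Odd (multiplicity π f) then rankOneOrZero (AdjoinRoot.mk π (f / π ^ multiplicity π f)) else 0

theorem pi_ne_zero : π ≠ 0 := (Fact.out : Irreducible π).ne_zero

theorem polyResidue_pow_mul (i : ℕ) (g : K[X]) (hg : ¬π ∣ g) :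
    polyResidue π (π ^ i * g) =
      open scoped Classical in if Odd i then rankOneOrZero (AdjoinRoot.mk π g) else 0 := by
  have hm : multiplicity π (π ^ i * g) = i := by
    refine multiplicity_eq_of_dvd_of_not_dvd (Dvd.intro _ rfl) ?_
    rw [pow_succ]
    exact fun h => hg ((mul_dvd_mul_iff_left (pow_ne_zero _ (pi_ne_zero π))).mp h)
  rw [polyResidue, hm, mul_div_cancel_left₀ _ (pow_ne_zero _ (pi_ne_zero π))]

theorem exists_pow_mul (f : K[X]) (hf : f ≠ 0) : ∃ i g, ¬π ∣ g ∧ f = π ^ i * g :=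
  WfDvdMonoid.max_power_factor hf Fact.out

theorem not_dvd_mul {f g : K[X]} (hf : ¬π ∣ f) (hg : ¬π ∣ g) : ¬π ∣ f * g := fun h =>
  ((Fact.out : Irreducible π).prime.dvd_or_dvd h).elim hf hg

theorem mk_ne_zero {g : K[X]} (hg : ¬π ∣ g) : AdjoinRoot.mk π g ≠ 0 := fun h =>
  hg (AdjoinRoot.mk_eq_zero.mp h)

theorem two_ne_zero_adjoinRoot (hK : ringChar K ≠ 2) : (2 : AdjoinRoot π) ≠ 0 := by
  have := (algebraMap K (AdjoinRoot π)).injective.ne (Ring.two_ne_zero hK)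
  rwa [map_ofNat, map_zero] at this

theorem two_ne_zero_ratFunc (hK : ringChar K ≠ 2) : (2 : RatFunc K) ≠ 0 := by
  have := (algebraMap K (RatFunc K)).injective.ne (Ring.two_ne_zero hK)
  rwa [map_ofNat, map_zero] at this

theorem polyResidue_mul_sq (f h : K[X]) (hf : f ≠ 0) (hh : h ≠ 0) :
    polyResidue π (f * h ^ 2) = polyResidue π f := by
  obtain ⟨i, g, hg, rfl⟩ := exists_pow_mul π f hf
  obtain ⟨j, k, hk, rfl⟩ := exists_pow_mul π h hh
  have e : π ^ i * g * (π ^ j * k) ^ 2 = π ^ (i + 2 * j) * (g * k ^ 2) := by ring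
  have hk2 : ¬π ∣ k ^ 2 := fun h => hk ((Fact.out : Irreducible π).prime.dvd_of_dvd_pow h)
  rw [e, polyResidue_pow_mul π _ _ (not_dvd_mul π hg hk2), polyResidue_pow_mul π _ _ hg, map_mul,
    map_pow, rankOneOrZero_mul_sq _ _ (mk_ne_zero π hg) (mk_ne_zero π hk)]
  simp [Nat.odd_add]

theorem polyResidue_add_neg (hK : ringChar K ≠ 2) (f : K[X]) (hf : f ≠ 0) :
    polyResidue π f + polyResidue π (-f) = 0 := by
  obtain ⟨i, g, hg, rfl⟩ := exists_pow_mul π f hf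
  rw [← mul_neg, polyResidue_pow_mul π _ _ hg,
    polyResidue_pow_mul π _ _ (fun h => hg ((dvd_neg).mp h)), map_neg]
  split_ifs
  · exact rankOneOrZero_add_neg (two_ne_zero_adjoinRoot π hK) _ (mk_ne_zero π hg)
  · exact add_zero 0

theorem polyResidue_add_of_lt (i d : ℕ) (a b : K[X]) (ha : ¬π ∣ a) (hb : ¬π ∣ b) :
    polyResidue π (π ^ i * a) + polyResidue π (π ^ (i + (d + 1)) * b) =
      polyResidue π (π ^ i * a + π ^ (i + (d + 1)) * b) +
        polyResidue π (π ^ i * a * (π ^ (i + (d + 1)) * b) *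
          (π ^ i * a + π ^ (i + (d + 1)) * b)) := by
  have hs : ¬π ∣ a + π ^ (d + 1) * b := fun h =>
    ha ((dvd_add_left (Dvd.dvd.mul_right (dvd_pow_self π d.succ_ne_zero) b)).mp h)
  have e1 : π ^ i * a + π ^ (i + (d + 1)) * b = π ^ i * (a + π ^ (d + 1) * b) := by ring
  have e2 : π ^ i * a * (π ^ (i + (d + 1)) * b) * (π ^ i * (a + π ^ (d + 1) * b)) =
      π ^ (i + (d + 1) + 2 * i) * (b * (a * (a + π ^ (d + 1) * b))) := by ring
  have hm : AdjoinRoot.mk π (a + π ^ (d + 1) * b) = AdjoinRoot.mk π a := by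
    simp [pow_succ]
  rw [e1, e2, polyResidue_pow_mul π _ _ ha, polyResidue_pow_mul π _ _ hb,
    polyResidue_pow_mul π _ _ hs,
    polyResidue_pow_mul π _ _ (not_dvd_mul π hb (not_dvd_mul π ha hs)), map_mul, map_mul, hm,
    ← pow_two, rankOneOrZero_mul_sq _ _ (mk_ne_zero π hb) (mk_ne_zero π ha)]
  simp [Nat.odd_add]

theorem polyResidue_add (hK : ringChar K ≠ 2) (x y : K[X]) (hx : x ≠ 0) (hy : y ≠ 0)
    (hxy : x + y ≠ 0) :
    polyResidue π x + polyResidue π y =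
      polyResidue π (x + y) + polyResidue π (x * y * (x + y)) := by
  obtain ⟨i, a, ha, rfl⟩ := exists_pow_mul π x hx
  obtain ⟨j, b, hb, rfl⟩ := exists_pow_mul π y hy
  rcases lt_trichotomy i j with h | h | h
  · obtain ⟨d, rfl⟩ := Nat.exists_eq_add_of_lt h
    exact polyResidue_add_of_lt π i d a b ha hb
  · subst h
    by_cases hs : π ∣ a + b
    · have hab : a + b ≠ 0 := fun h => hxy (by rw [← mul_add, h, mul_zero])
      obtain ⟨m, c, hc, hmc⟩ := exists_pow_mul π (a + b) hab
      have hba : AdjoinRoot.mk π b = -AdjoinRoot.mk π a := by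
        rw [eq_neg_iff_add_eq_zero, ← map_add, add_comm]
        exact AdjoinRoot.mk_eq_zero.mpr hs
      have e1 : π ^ i * a + π ^ i * b = π ^ (i + m) * c := by
        rw [← mul_add, hmc]; ring
      have e2 : π ^ i * a * (π ^ i * b) * (π ^ (i + m) * c) =
          π ^ ((i + m) + 2 * i) * (c * (a * b)) := by ring
      rw [e1, e2, polyResidue_pow_mul π _ _ ha, polyResidue_pow_mul π _ _ hb,
        polyResidue_pow_mul π _ _ hc,
        polyResidue_pow_mul π _ _ (not_dvd_mul π hc (not_dvd_mul π ha hb)), map_mul, map_mul, hba]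
      have e3 : AdjoinRoot.mk π c * (AdjoinRoot.mk π a * -AdjoinRoot.mk π a) =
          -AdjoinRoot.mk π c * AdjoinRoot.mk π a ^ 2 := by ring
      rw [e3, rankOneOrZero_mul_sq _ _ (neg_ne_zero.mpr (mk_ne_zero π hc)) (mk_ne_zero π ha)]
      have h1 := rankOneOrZero_add_neg (two_ne_zero_adjoinRoot π hK) _ (mk_ne_zero π ha)
      have h3 := rankOneOrZero_add_neg (two_ne_zero_adjoinRoot π hK) _ (mk_ne_zero π hc)
      have h4 : Odd (i + m + 2 * i) ↔ Odd (i + m) := by simp [Nat.odd_add (m := i + m)]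
      simp only [h4]
      split_ifs <;> simp [h1, h3]
    · have e1 : π ^ i * a + π ^ i * b = π ^ i * (a + b) := by ring
      have e2 : π ^ i * a * (π ^ i * b) * (π ^ i * (a + b)) =
          π ^ (i + 2 * i) * (a * b * (a + b)) := by ring
      rw [e1, e2, polyResidue_pow_mul π _ _ ha, polyResidue_pow_mul π _ _ hb,
        polyResidue_pow_mul π _ _ hs,
        polyResidue_pow_mul π _ _ (not_dvd_mul π (not_dvd_mul π ha hb) hs)]
      have h4 : Odd (i + 2 * i) ↔ Odd i := by simp [Nat.odd_add (m := i)]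
      simp only [h4, map_mul, map_add]
      split_ifs
      · refine rankOneOrZero_add _ _ (mk_ne_zero π ha) (mk_ne_zero π hb) ?_
        rw [← map_add]; exact mk_ne_zero π hs
      · rfl
  · obtain ⟨d, rfl⟩ := Nat.exists_eq_add_of_lt h
    have := polyResidue_add_of_lt π j d b a hb ha
    rw [add_comm (polyResidue π _), mul_comm (π ^ (j + d + 1) * a),
      add_comm (π ^ (j + d + 1) * a)]
    exact this

/-- The residue of the form `(K(X), q)`: if `q = π ^ m * u` with `u` a unit of the local ring at
`π`, it is the class of `u` modulo `π` for odd `m`, and `0` for even `m`. -/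
noncomputable def ratResidue (q : RatFunc K) : WittGroup (AdjoinRoot π) :=
  polyResidue π (q.num * q.denom)

theorem ratResidue_div (a d : K[X]) (ha : a ≠ 0) (hd : d ≠ 0) :
    ratResidue π (algebraMap K[X] (RatFunc K) a / algebraMap K[X] (RatFunc K) d) =
      polyResidue π (a * d) := by
  set q := algebraMap K[X] (RatFunc K) a / algebraMap K[X] (RatFunc K) d with hq
  have hd' : algebraMap K[X] (RatFunc K) d ≠ 0 := RatFunc.algebraMap_ne_zero hd
  have hn' : algebraMap K[X] (RatFunc K) q.denom ≠ 0 :=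
    RatFunc.algebraMap_ne_zero q.denom_ne_zero
  have hq0 : q ≠ 0 := div_ne_zero (RatFunc.algebraMap_ne_zero ha) hd'
  have h1 : q.num * d = a * q.denom := by
    apply RatFunc.algebraMap_injective K
    rw [map_mul, map_mul]
    have := (RatFunc.num_div_denom q).trans hq
    rwa [div_eq_div_iff hn' hd'] at this
  have h2 : q.num * q.denom * d ^ 2 = a * d * q.denom ^ 2 := by
    linear_combination q.denom * d * h1
  rw [ratResidue, ← polyResidue_mul_sq π _ d
    (mul_ne_zero (RatFunc.num_ne_zero hq0) q.denom_ne_zero) hd, h2,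
    polyResidue_mul_sq π _ _ (mul_ne_zero ha hd) q.denom_ne_zero]

theorem exists_div (q : RatFunc K) (hq : q ≠ 0) : ∃ a d : K[X], a ≠ 0 ∧ d ≠ 0 ∧
    q = algebraMap K[X] (RatFunc K) a / algebraMap K[X] (RatFunc K) d :=
  ⟨q.num, q.denom, RatFunc.num_ne_zero hq, q.denom_ne_zero, (RatFunc.num_div_denom q).symm⟩

theorem ratResidue_mul_sq (x y : RatFunc K) (hx : x ≠ 0) (hy : y ≠ 0) :
    ratResidue π (x * y ^ 2) = ratResidue π x := by
  obtain ⟨a, d, ha, hd, rfl⟩ := exists_div x hx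
  obtain ⟨b, c, hb, hc, rfl⟩ := exists_div y hy
  have e : algebraMap K[X] (RatFunc K) a / algebraMap K[X] (RatFunc K) d *
      (algebraMap K[X] (RatFunc K) b / algebraMap K[X] (RatFunc K) c) ^ 2 =
      algebraMap K[X] (RatFunc K) (a * b ^ 2) / algebraMap K[X] (RatFunc K) (d * c ^ 2) := by
    simp only [map_mul, map_pow]; rw [div_pow, div_mul_div_comm]
  rw [e, ratResidue_div π _ _ (by positivity) (by positivity), ratResidue_div π _ _ ha hd]
  have e2 : a * b ^ 2 * (d * c ^ 2) = a * d * (b * c) ^ 2 := by ring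
  rw [e2, polyResidue_mul_sq π _ _ (mul_ne_zero ha hd) (mul_ne_zero hb hc)]

theorem ratResidue_add_neg (hK : ringChar K ≠ 2) (x : RatFunc K) (hx : x ≠ 0) :
    ratResidue π x + ratResidue π (-x) = 0 := by
  obtain ⟨a, d, ha, hd, rfl⟩ := exists_div x hx
  rw [← neg_div, ← map_neg, ratResidue_div π _ _ ha hd,
    ratResidue_div π _ _ (neg_ne_zero.mpr ha) hd, neg_mul,
    polyResidue_add_neg π hK _ (mul_ne_zero ha hd)]

theorem ratResidue_add (hK : ringChar K ≠ 2) (x y : RatFunc K) (hx : x ≠ 0) (hy : y ≠ 0)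
    (hxy : x + y ≠ 0) :
    ratResidue π x + ratResidue π y = ratResidue π (x + y) + ratResidue π (x * y * (x + y)) := by
  obtain ⟨a, d, ha, hd, rfl⟩ := exists_div x hx
  obtain ⟨b, c, hb, hc, rfl⟩ := exists_div y hy
  have hd' : algebraMap K[X] (RatFunc K) d ≠ 0 := RatFunc.algebraMap_ne_zero hd
  have hc' : algebraMap K[X] (RatFunc K) c ≠ 0 := RatFunc.algebraMap_ne_zero hc
  have e0 : algebraMap K[X] (RatFunc K) a / algebraMap K[X] (RatFunc K) d =
      algebraMap K[X] (RatFunc K) (a * c) / algebraMap K[X] (RatFunc K) (d * c) := by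
    simp only [map_mul]; field_simp
  have e0' : algebraMap K[X] (RatFunc K) b / algebraMap K[X] (RatFunc K) c =
      algebraMap K[X] (RatFunc K) (b * d) / algebraMap K[X] (RatFunc K) (d * c) := by
    simp only [map_mul]; field_simp
  rw [e0, e0'] at hxy ⊢
  have ha' := mul_ne_zero ha hc
  have hb' := mul_ne_zero hb hd
  have hm := mul_ne_zero hd hc
  generalize a * c = a at *
  generalize b * d = b at *
  generalize d * c = m at *
  have hm' : algebraMap K[X] (RatFunc K) m ≠ 0 := RatFunc.algebraMap_ne_zero hm
  rw [← add_div, ← map_add] at hxy ⊢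
  have hab : a + b ≠ 0 := by
    rintro h
    rw [h, map_zero, zero_div] at hxy
    exact hxy rfl
  have e1 : algebraMap K[X] (RatFunc K) a / algebraMap K[X] (RatFunc K) m *
      (algebraMap K[X] (RatFunc K) b / algebraMap K[X] (RatFunc K) m) *
      (algebraMap K[X] (RatFunc K) (a + b) / algebraMap K[X] (RatFunc K) m) =
      algebraMap K[X] (RatFunc K) (a * b * (a + b)) / algebraMap K[X] (RatFunc K) (m ^ 3) := by
    simp only [map_mul, map_pow]; field_simp
  have e2 : a * b * (a + b) * m ^ 3 = a * m * (b * m) * (a * m + b * m) := by ring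
  rw [e1, ratResidue_div π _ _ ha' hm, ratResidue_div π _ _ hb' hm, ratResidue_div π _ _ hab hm,
    ratResidue_div π _ _ (mul_ne_zero (mul_ne_zero ha' hb') hab) (pow_ne_zero 3 hm), e2, add_mul]
  exact polyResidue_add π hK _ _ (mul_ne_zero ha' hm) (mul_ne_zero hb' hm)
    (by rw [← add_mul]; exact mul_ne_zero hab hm)

/-- The residue homomorphism `res_π : W(K(X)) → W(K[X]/π)`. -/
noncomputable def residue (hK : ringChar K ≠ 2) : WittGroup (RatFunc K) →+
    WittGroup (AdjoinRoot π) :=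
  lift (NonsingularForm.diagSum (two_ne_zero_ratFunc hK) (ratResidue π))
    (NonsingularForm.diagSum_congr _ _ (ratResidue_mul_sq π) (ratResidue_add π hK))
    (NonsingularForm.diagSum_eq _ _ (ratResidue_mul_sq π) (ratResidue_add π hK) _ []
      ⟨List.Pairwise.nil, fun _ h => absurd h List.not_mem_nil⟩ (Subsingleton.elim _ _))
    (NonsingularForm.diagSum_sum _ _ (ratResidue_mul_sq π) (ratResidue_add π hK))
    (NonsingularForm.diagSum_hyperbolic _ _ (ratResidue_mul_sq π) (ratResidue_add π hK)
      (ratResidue_add_neg π hK))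

theorem residue_rankOne (hK : ringChar K ≠ 2) (q : RatFunc K) (hq : q ≠ 0) :
    residue π hK (rankOne q hq) = ratResidue π q := by
  refine (lift_mk _ _ _ _ _ _).trans ?_
  have hf : (NonsingularForm.rankOne q hq).form (1 : RatFunc K) (1 : RatFunc K) = q := by simp
  rw [NonsingularForm.diagSum_eq _ _ (ratResidue_mul_sq π) (ratResidue_add π hK) _
    [(1 : RatFunc K)] ⟨List.pairwise_singleton _ _, ?_⟩ ?_]
  · simp only [List.map_cons, List.map_nil, List.sum_cons, List.sum_nil, add_zero, hf]
  · intro x hx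
    rw [List.mem_singleton.mp hx, hf]; exact hq
  · have : {x : RatFunc K | x ∈ [(1 : RatFunc K)]} = {1} := by ext; simp
    rw [this]
    exact Ideal.span_singleton_one

/-- `res_π [u] = 0` for a unit `u = a / b` of the local ring at `π`. -/
theorem residue_unit (hK : ringChar K ≠ 2) (a b : K[X]) (ha : ¬π ∣ a) (hb : ¬π ∣ b)
    (hab : algebraMap K[X] (RatFunc K) a / algebraMap K[X] (RatFunc K) b ≠ 0) :
    residue π hK (rankOne _ hab) = 0 := by
  have ha0 : a ≠ 0 := by rintro rfl; exact ha (dvd_zero π)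
  have hb0 : b ≠ 0 := by rintro rfl; exact hb (dvd_zero π)
  rw [residue_rankOne, ratResidue_div π a b ha0 hb0]
  simpa using polyResidue_pow_mul π 0 _ (not_dvd_mul π ha hb)

/-- `res_π [π u]` is the class of `u` modulo `π` for a unit `u = a / b` of the local ring at
`π`. -/
theorem residue_uniformizer (hK : ringChar K ≠ 2) (a b : K[X]) (ha : ¬π ∣ a) (hb : ¬π ∣ b)
    (h : algebraMap K[X] (RatFunc K) π *
      (algebraMap K[X] (RatFunc K) a / algebraMap K[X] (RatFunc K) b) ≠ 0) :
    residue π hK (rankOne _ h) =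
      rankOne (AdjoinRoot.mk π a / AdjoinRoot.mk π b)
        (div_ne_zero (mk_ne_zero π ha) (mk_ne_zero π hb)) := by
  have ha0 : a ≠ 0 := by rintro rfl; exact ha (dvd_zero π)
  have hb0 : b ≠ 0 := by rintro rfl; exact hb (dvd_zero π)
  have hb' := mk_ne_zero π hb
  have e := polyResidue_pow_mul π 1 _ (not_dvd_mul π ha hb)
  rw [if_pos odd_one, pow_one, ← mul_assoc, map_mul] at e
  have e3 : AdjoinRoot.mk π a * AdjoinRoot.mk π b =
      AdjoinRoot.mk π a / AdjoinRoot.mk π b * AdjoinRoot.mk π b ^ 2 := by field_simp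
  rw [residue_rankOne, ← mul_div_assoc, ← map_mul,
    ratResidue_div π _ b (mul_ne_zero (pi_ne_zero π) ha0) hb0, e, e3,
    rankOneOrZero_mul_sq _ _ (div_ne_zero (mk_ne_zero π ha) hb') hb', rankOneOrZero_of_ne]

end Residue

end WittGroup

/-- The tridiagonal symmetric matrix with diagonal entries `χ₁, …, χₙ` and entries `1` next to the
diagonal. -/
def tri {R : Type*} [CommRing R] (χ : List R) : Matrix (Fin χ.length) (Fin χ.length) R :=
  Matrix.of fun i j =>
    if i = j then χ.get i else if (i : ℕ) + 1 = j ∨ (j : ℕ) + 1 = i then 1 else 0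

theorem tri_isSymm {R : Type*} [CommRing R] (χ : List R) : (tri χ).IsSymm := by
  ext i j
  by_cases h : i = j
  · subst h; rfl
  · simp [tri, h, Ne.symm h, or_comm]

/-- The quotients of the Euclidean algorithm with changed signs
`P₀ = A`, `P₁ = B`, `Pₖ₊₁ = Pₖ Qₖ - Pₖ₋₁`, `deg Pₖ₊₁ < deg Pₖ`, stopped when `Pₙ₊₁ = 0`:
the list `Q₁, …, Qₙ`. -/
noncomputable def signedEuclid {K : Type*} [Field K] (A B : K[X]) : List K[X] :=
  open scoped Classical in
  if h : B = 0 then [] else (A / B) :: signedEuclid B (-(A % B))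
termination_by B.degree
decreasing_by
  rw [degree_neg]
  exact EuclideanDomain.mod_lt A h

/-- The Sturm quotients `Q₁, …, Qₙ` of `P`: `P₀ = P`, `P₁ = P'`. -/
noncomputable def sturmQuotients {K : Type*} [Field K] (P : K[X]) : List K[X] :=
  signedEuclid P (derivative P)

/-- The Sturm matrix `Tri(Q)` of `P`, over `K(X)`. -/
noncomputable def sturmMatrix {K : Type*} [Field K] (P : K[X]) :
    Matrix (Fin (sturmQuotients P).length) (Fin (sturmQuotients P).length) (RatFunc K) :=
  (tri (sturmQuotients P)).map (algebraMap K[X] (RatFunc K))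

theorem sturmMatrix_isSymm {K : Type*} [Field K] (P : K[X]) : (sturmMatrix P).IsSymm :=
  (tri_isSymm _).map _

/-! Let P₀ = P, P₁ = P', …, Pₙ be the signed remainders. Bordering a nonsingular symmetric matrix by
one row and one column adds an orthogonal line to its form, and the value on a suitable generator of
that line is the Schur complement (`WittGroup.ofMatrix_bordered`). For the tail of Tri(Q) that
starts at Qₖ, this complement is Qₖ minus the top left entry of the inverse of the next tail. By the
continued fraction expansion that entry is Pₖ₊₁/Pₖ, so the recursion turns the complement into
Pₖ₋₁/Pₖ. All complements are nonzero, hence so is the determinant, and [Tri(Q)] = Σ [Pₖ₋₁/Pₖ] = Σ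
[Pₖ₋₁Pₖ], because scaling by a square does not change a class.

The residues of this sum telescope. Consecutive remainders are coprime, so if π divides Pₖ with 1 ≤
k < n, it divides neither neighbour, and Pₖ₋₁ + Pₖ₊₁ = PₖQₖ gives Pₖ₊₁ ≡ -Pₖ₋₁ modulo π. The
residues of [Pₖ₋₁Pₖ] and [PₖPₖ₊₁] are then opposite (`WittGroup.polyResidue_mul_add_eq_zero`). The
last remainder Pₙ is a unit, so only the residue of [PP'] at divisors of P survives. The induction
`WittGroup.residue_tri_signedEuclid` carries this out for an arbitrary coprime pair, because the
algorithm replaces (P, P') by later pairs.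

Finally, if P = πu, then P' ≡ π'u modulo π, so PP' is π times an element congruent to π'u², with
residue [π']. -/

/-! ### Bordered matrices and the Schur complement q - ε·S⁻¹ε. -/

namespace Matrix

/-- The matrix obtained from `S` by adding a first row and a first column `(q, ε)`. -/
def bordered {R : Type*} {n : ℕ} (q : R) (ε : Fin n → R) (S : Matrix (Fin n) (Fin n) R) :
    Matrix (Fin (n + 1)) (Fin (n + 1)) R :=
  Matrix.of (Fin.cons (Fin.cons q ε) fun i => Fin.cons (ε i) (S i))

theorem bordered_mulVec_cons {R : Type*} [CommRing R] {n : ℕ} (q : R) (ε : Fin n → R)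
    (S : Matrix (Fin n) (Fin n) R) (a : R) (x : Fin n → R) :
    bordered q ε S *ᵥ (Fin.cons a x : Fin (n + 1) → R) =
      (Fin.cons (q * a + ε ⬝ᵥ x) (a • ε + S *ᵥ x) : Fin (n + 1) → R) := by
  ext i
  refine Fin.cases ?_ (fun i => ?_) i
  · simp [bordered, mulVec, dotProduct, Fin.sum_univ_succ]
  · simp [bordered, mulVec, dotProduct, Fin.sum_univ_succ, mul_comm]

theorem finCons_dotProduct_finCons {R : Type*} [CommRing R] {n : ℕ} (a b : R) (x y : Fin n → R) :
    (Fin.cons a x : Fin (n + 1) → R) ⬝ᵥ (Fin.cons b y : Fin (n + 1) → R) =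
      a * b + x ⬝ᵥ y := by
  simp [dotProduct, Fin.sum_univ_succ]

section Field

variable {F : Type*} [Field F] {n : ℕ} {q : F} {ε v : Fin n → F} {S : Matrix (Fin n) (Fin n) F}

/-- The determinant is the Schur complement times `S.det`. Only nonvanishing is needed, and it
follows from solving for a kernel vector. The vector `v` plays the role of S⁻¹ε, so that no inverse
matrix appears. -/
theorem det_bordered_ne_zero (hdet : S.det ≠ 0) (hv : S *ᵥ v = ε) (hp : q - ε ⬝ᵥ v ≠ 0) :
    (bordered q ε S).det ≠ 0 := by
  intro h
  obtain ⟨w, hw, hw0⟩ := exists_mulVec_eq_zero_iff.mpr h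
  obtain ⟨a, x, rfl⟩ : ∃ a x, w = (Fin.cons a x : Fin (n + 1) → F) :=
    ⟨w 0, Fin.tail w, (Fin.cons_self_tail w).symm⟩
  rw [bordered_mulVec_cons] at hw0
  have h0 : q * a + ε ⬝ᵥ x = 0 := congrFun hw0 0
  -- The lower rows say S x = -aε = -S(a v), which forces x = -a v; the top row then becomes (q -
  -- ε·v) a = 0.
  have h1 : S *ᵥ (x + a • v) = 0 := by
    rw [mulVec_add, mulVec_smul, hv, add_comm]
    exact funext fun i => congrFun hw0 i.succ
  have hx : x = -(a • v) := by
    by_contra hx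
    exact hdet (exists_mulVec_eq_zero_iff.mp
      ⟨x + a • v, fun h => hx (eq_neg_of_add_eq_zero_left h), h1⟩)
  have ha : a = 0 := by
    rw [hx, dotProduct_neg, dotProduct_smul, smul_eq_mul] at h0
    exact (mul_eq_zero.mp (show (q - ε ⬝ᵥ v) * a = 0 by linear_combination h0)).resolve_left hp
  subst ha
  rw [hx] at hw
  exact hw (funext fun i => by refine Fin.cases ?_ (fun i => ?_) i <;> simp)

/-- This is the first column of the inverse. Its top entry 1/(q - ε·v) is one step of a continued
fraction, and the column serves as the next `v` when a further row is added. -/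
theorem bordered_mulVec_eq_single (hv : S *ᵥ v = ε) (hp : q - ε ⬝ᵥ v ≠ 0) :
    bordered q ε S *ᵥ (Fin.cons (q - ε ⬝ᵥ v)⁻¹ (-((q - ε ⬝ᵥ v)⁻¹ • v)) : Fin (n + 1) → F) =
      Pi.single 0 1 := by
  rw [bordered_mulVec_cons, mulVec_neg, mulVec_smul, hv, add_neg_cancel, dotProduct_neg,
    dotProduct_smul, smul_eq_mul]
  ext i
  refine Fin.cases ?_ (fun i => ?_) i
  · simp only [Fin.cons_zero, Pi.single_eq_same]
    rw [← sub_eq_add_neg, mul_comm q, ← mul_sub, inv_mul_cancel₀ hp]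
  · simp

end Field

end Matrix

/-! ### Splitting off an orthogonal line in the Witt group. -/

/-- The vector (1, -v) is orthogonal to 0 × Fⁿ because S v = ε, and its value under the form is q -
ε·v. -/
theorem WittGroup.ofMatrix_bordered {F : Type u} [Field F] {n : ℕ} {q : F} {ε v : Fin n → F}
    {S : Matrix (Fin n) (Fin n) F} (hS : S.IsSymm) (hdet : S.det ≠ 0) (hv : S.mulVec v = ε)
    (hp : q - ε ⬝ᵥ v ≠ 0) (hS' : (Matrix.bordered q ε S).IsSymm)
    (hdet' : (Matrix.bordered q ε S).det ≠ 0) :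
    ofMatrix (Matrix.bordered q ε S) hS' hdet' = rankOne (q - ε ⬝ᵥ v) hp + ofMatrix S hS hdet := by
  rw [ofMatrix, ofMatrix, rankOne, ← mk_sum]
  refine (mk_eq (NonsingularForm.equiv_of
    (M := (NonsingularForm.rankOne (q - ε ⬝ᵥ v) hp).sum (NonsingularForm.ofMatrix S hS hdet))
    (N := NonsingularForm.ofMatrix (Matrix.bordered q ε S) hS' hdet')
    -- The change of basis sends (a, x) to a(1, -v) + (0, x).
    ({ toFun := fun p => Fin.cons p.1 (p.2 - p.1 • v)
       map_add' := fun p p' => by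
        ext i; refine Fin.cases ?_ (fun i => ?_) i <;> simp; ring
       map_smul' := fun c p => by
        ext i; refine Fin.cases ?_ (fun i => ?_) i <;> simp; ring
       invFun := fun y => (y 0, Fin.tail y + y 0 • v)
       left_inv := fun p => by ext <;> simp
       right_inv := fun y => by
        ext i; refine Fin.cases ?_ (fun i => ?_) i <;> simp [Fin.tail] } :
      (F × (Fin n → F)) ≃ₗ[F] (Fin (n + 1) → F)) fun x y => ?_)).symm
  obtain ⟨a, x⟩ := x
  obtain ⟨b, y⟩ := y
  -- The symmetry of S moves it onto v, where S v = ε; this removes the cross terms.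
  have hvx : ∀ z, v ⬝ᵥ S.mulVec z = ε ⬝ᵥ z := fun z => by
    rw [Matrix.dotProduct_mulVec, ← Matrix.mulVec_transpose, hS.eq, hv]
  change Matrix.toBilin' (Matrix.bordered q ε S) (Fin.cons a (x - a • v)) (Fin.cons b (y - b • v)) =
    (q - ε ⬝ᵥ v) * (a * b) + Matrix.toBilin' S x y
  rw [Matrix.toBilin'_apply', Matrix.toBilin'_apply', Matrix.bordered_mulVec_cons,
    Matrix.finCons_dotProduct_finCons, Matrix.mulVec_sub, Matrix.mulVec_smul, hv, add_sub_cancel,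
    dotProduct_sub, dotProduct_smul, sub_dotProduct, smul_dotProduct, hvx]
  simp only [smul_eq_mul]
  ring

/-! ### One step of the tridiagonal matrix and of the signed Euclidean algorithm. -/

/-- The first row of `tri (q :: χ)` without its first entry. -/
def firstCoord (R : Type*) [Zero R] [One R] (n : ℕ) : Fin n → R := fun i =>
  if (i : ℕ) = 0 then 1 else 0

/-- `firstCoord` also makes sense for n = 0, where no basis vector exists; this lets the induction
start from the empty matrix. -/
theorem firstCoord_succ (R : Type*) [Zero R] [One R] (n : ℕ) :
    firstCoord R (n + 1) = Pi.single 0 1 := by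
  ext i
  refine Fin.cases ?_ (fun i => ?_) i <;> simp [firstCoord]

/-- The first row meets the tail only in its first coordinate, so the Schur complement involves only
the top left entry of the inverse of the tail. -/
theorem tri_cons_map {R S : Type*} [CommRing R] [CommRing S] (f : R →+* S) (q : R) (χ : List R) :
    (tri (q :: χ)).map f =
      Matrix.bordered (f q) (firstCoord S χ.length) ((tri χ).map f) := by
  ext i j
  refine Fin.cases ?_ (fun i => ?_) i <;> refine Fin.cases ?_ (fun j => ?_) j
  · simp [tri, Matrix.bordered]
  · simp [tri, Matrix.bordered, firstCoord, Fin.ext_iff, eq_comm, apply_ite f]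
  · simp [tri, Matrix.bordered, firstCoord, Fin.ext_iff, eq_comm, apply_ite f]
  · simp [tri, Matrix.bordered, Fin.ext_iff, apply_ite f]

theorem signedEuclid_zero {K : Type*} [Field K] (A : K[X]) : signedEuclid A 0 = [] := by
  rw [signedEuclid, dif_pos rfl]

theorem signedEuclid_of_ne {K : Type*} [Field K] (A : K[X]) {B : K[X]} (hB : B ≠ 0) :
    signedEuclid A B = (A / B) :: signedEuclid B (-(A % B)) := by
  rw [signedEuclid, dif_neg hB]

/-! ### Cancellation of residues along the remainder sequence. -/

namespace WittGroup

variable {K : Type u} [Field K] (π : K[X]) [Fact (Irreducible π)]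

theorem polyResidue_of_not_dvd {f : K[X]} (hf : ¬π ∣ f) : polyResidue π f = 0 := by
  simpa using polyResidue_pow_mul π 0 f hf

/-- This makes the sum telescope, with A, B, C three consecutive remainders. If B = πⁱg with g prime
to π, both residues vanish for even i, and for odd i they are [Ag] and [-Ag], since C ≡ -A modulo π.
-/
theorem polyResidue_mul_add_eq_zero (hK : ringChar K ≠ 2) {A B C : K[X]} (hB : B ≠ 0)
    (hA : ¬π ∣ A) (hAC : π ∣ A + C) : polyResidue π (A * B) + polyResidue π (B * C) = 0 := by
  obtain ⟨i, g, hg, rfl⟩ := exists_pow_mul π B hB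
  have hC : ¬π ∣ C := fun h => hA ((dvd_add_left h).mp hAC)
  have hCA : AdjoinRoot.mk π C = -AdjoinRoot.mk π A := by
    rw [eq_neg_iff_add_eq_zero, ← map_add, add_comm]
    exact AdjoinRoot.mk_eq_zero.mpr hAC
  rw [mul_left_comm, mul_assoc, polyResidue_pow_mul π _ _ (not_dvd_mul π hA hg),
    polyResidue_pow_mul π _ _ (not_dvd_mul π hg hC), map_mul, map_mul, hCA, mul_neg,
    mul_comm (AdjoinRoot.mk π g)]
  split_ifs
  · exact rankOneOrZero_add_neg (two_ne_zero_adjoinRoot π hK) _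
      (mul_ne_zero (mk_ne_zero π hA) (mk_ne_zero π hg))
  · exact add_zero 0

theorem not_dvd_of_isCoprime {A B : K[X]} (h : IsCoprime A B) (hA : π ∣ A) : ¬π ∣ B := fun hB =>
  (Fact.out : Irreducible π).not_isUnit (h.isUnit_of_dvd' hA hB)

open scoped Classical in
/-- The Witt class of the tridiagonal form of the signed Euclidean algorithm of two coprime
polynomials `A ≠ 0` and `B` has the residue of `[A B]` at the divisors of `A`, and residue zero
elsewhere. The last part is the continued fraction expansion of `B / A`. -/
theorem residue_tri_signedEuclid (hK : ringChar K ≠ 2) (A B : K[X]) (hA : A ≠ 0)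
    (hAB : IsCoprime A B) :
    ∃ hdet : ((tri (signedEuclid A B)).map (algebraMap K[X] (RatFunc K))).det ≠ 0,
      residue π hK (ofMatrix _ ((tri_isSymm (signedEuclid A B)).map _) hdet) =
        (if π ∣ A then polyResidue π (A * B) else 0) ∧
      ∃ v, ((tri (signedEuclid A B)).map (algebraMap K[X] (RatFunc K))).mulVec v =
          firstCoord (RatFunc K) _ ∧
        firstCoord (RatFunc K) _ ⬝ᵥ v =
          algebraMap K[X] (RatFunc K) B / algebraMap K[X] (RatFunc K) A := by
  -- The recursion changes both polynomials, so both vary in the induction; degrees include that of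
  -- 0, the terminal case.
  induction hd : B.degree using WellFoundedLT.induction generalizing A B with
  | ind d ih =>
  by_cases hB : B = 0
  · subst hB
    -- A polynomial coprime to 0 is a unit.
    have hπA : ¬π ∣ A := fun h => not_dvd_of_isCoprime π hAB h (dvd_zero π)
    rw [signedEuclid_zero, if_neg hπA]
    refine ⟨by simp [tri], ?_, 0, Subsingleton.elim (α := Fin 0 → RatFunc K) _ _, by simp⟩
    -- The form lives on the zero space, so ⊤ and ⊥ are both isotropic and complementary.
    rw [ofMatrix, mk_hyperbolic, map_zero]
    refine ⟨⊤, ⊥, isCompl_top_bot, ?_, ?_⟩ <;> intro x _ y _ <;>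
      rw [(Subsingleton.elim (α := Fin 0 → RatFunc K) x 0 : x = 0)] <;>
      exact LinearMap.BilinForm.zero_left _
  · have hC : A + -(A % B) = B * (A / B) := by
      linear_combination (EuclideanDomain.div_add_mod A B).symm
    -- The next remainder is -A plus a multiple of B, so coprimality is inherited.
    have hBC : IsCoprime B (-(A % B)) := by
      rw [show -(A % B) = -A + B * (A / B) by linear_combination hC]
      exact hAB.symm.neg_right.add_mul_left_right _
    rw [signedEuclid_of_ne A hB]
    -- The symmetry proof has the matrix in its type. Making it a variable allows the matrix to be
    -- rewritten in bordered form.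
    generalize (tri_isSymm (A / B :: signedEuclid B (-(A % B)))).map
      (algebraMap K[X] (RatFunc K)) = hsymm
    revert hsymm
    rw [tri_cons_map]
    intro hsymm
    have hdeg : (-(A % B)).degree < d := by
      rw [degree_neg, ← hd]
      exact EuclideanDomain.mod_lt A hB
    obtain ⟨hdet, hres, v, hv, hv'⟩ := ih _ hdeg B (-(A % B)) hB hBC rfl
    generalize -(A % B) = C at *
    have hA' := RatFunc.algebraMap_ne_zero hA
    have hB' := RatFunc.algebraMap_ne_zero hB
    -- On the left `A / B` is the polynomial quotient, on the right stands the fraction in K(X).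
    -- They differ by C/B, which the induction hypothesis supplies as `firstCoord · v`.
    have hp : algebraMap K[X] (RatFunc K) (A / B) - firstCoord (RatFunc K) _ ⬝ᵥ v =
        algebraMap K[X] (RatFunc K) A / algebraMap K[X] (RatFunc K) B := by
      have := congrArg (algebraMap K[X] (RatFunc K)) hC
      rw [map_add, map_mul] at this
      rw [hv']
      field_simp
      linear_combination -this
    have hp0 : algebraMap K[X] (RatFunc K) (A / B) - firstCoord (RatFunc K) _ ⬝ᵥ v ≠ 0 :=
      hp ▸ div_ne_zero hA' hB'
    refine ⟨Matrix.det_bordered_ne_zero hdet hv hp0, ?_, _,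
      (Matrix.bordered_mulVec_eq_single hv hp0).trans (firstCoord_succ _ _).symm, ?_⟩
    · rw [ofMatrix_bordered ((tri_isSymm _).map _) hdet hv hp0, map_add, hres, residue_rankOne, hp,
        ratResidue_div π A B hA hB]
      -- Here `h1` concerns π ∣ B and `h2` concerns π ∣ A. Coprimality excludes both at once; if
      -- only B is divisible by π, the new term cancels the residue of the tail.
      split_ifs with h1 h2 h2
      · exact absurd h1 (not_dvd_of_isCoprime π hAB h2)
      · exact polyResidue_mul_add_eq_zero π hK hB h2 (hC ▸ h1.mul_right _)
      · exact add_zero _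
      · rw [add_zero, polyResidue_of_not_dvd π (not_dvd_mul π h2 h1)]
    -- The top entry of the new column is the inverse of the Schur complement A/B, that is B/A,
    -- which continues the expansion.
    · refine (congrArg (· ⬝ᵥ _) (firstCoord_succ (RatFunc K) (signedEuclid B C).length)).trans ?_
      simp only [single_one_dotProduct, Fin.cons_zero, hp, inv_div]

end WittGroup

/-! ### The residues of the Sturm form. -/

theorem mainTheorem3 {K : Type u} [Field K] (hK : ringChar K ≠ 2)
    (P : K[X]) (hmonic : P.Monic) (hsep : P.Separable)
    (π : K[X]) [Fact (Irreducible π)] :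
    ∃ hdet : (sturmMatrix P).det ≠ 0,
      (¬π ∣ P →
        WittGroup.residue π hK
          (WittGroup.ofMatrix (sturmMatrix P) (sturmMatrix_isSymm P) hdet) = 0) ∧
      (π ∣ P →
        ∃ hπ' : AdjoinRoot.mk π (derivative π) ≠ 0,
          WittGroup.residue π hK
              (WittGroup.ofMatrix (sturmMatrix P) (sturmMatrix_isSymm P) hdet) =
            WittGroup.rankOne (AdjoinRoot.mk π (derivative π)) hπ') := by
  obtain ⟨hdet, hres, -⟩ :=
    WittGroup.residue_tri_signedEuclid π hK P (derivative P) hmonic.ne_zero hsep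
  refine ⟨hdet, fun h => hres.trans (if_neg h), fun h => ?_⟩
  have hder := WittGroup.not_dvd_of_isCoprime π hsep h
  obtain ⟨u, rfl⟩ := h
  -- The term π u' vanishes modulo π. Since P' is nonzero modulo π by separability, so are both π'
  -- and u; in particular π is a simple factor of P.
  have e : AdjoinRoot.mk π (derivative (π * u)) =
      AdjoinRoot.mk π (derivative π) * AdjoinRoot.mk π u := by simp [derivative_mul]
  have hne := WittGroup.mk_ne_zero π hder
  rw [e] at hne
  have hπ' := left_ne_zero_of_mul hne
  have hu := right_ne_zero_of_mul hne
  have hu' : ¬π ∣ u := fun h => hu (AdjoinRoot.mk_eq_zero.mpr h)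
  refine ⟨hπ', hres.trans ?_⟩
  -- The factor π occurs in PP' exactly once, with cofactor uP' ≡ π'u², and the square drops out.
  have hpow := WittGroup.polyResidue_pow_mul π 1 _ (WittGroup.not_dvd_mul π hu' hder)
  rw [pow_one, if_pos odd_one, ← mul_assoc, map_mul _ u, e, mul_left_comm, ← pow_two,
    WittGroup.rankOneOrZero_mul_sq _ _ hπ' hu, WittGroup.rankOneOrZero_of_ne hπ'] at hpow
  rw [if_pos (dvd_mul_right π u), hpow]
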